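/- Let $n\ge 2$ and $1<p<\infty$, let $(N^{n-1},g_0)$ be a (non-empty, smooth) Riemannian manifold of dimension $n-1$, and let $M^n=\mathbb{R}\times N$ be endowed with the warped metric $ds^2=dt^2+e^{2\rho(t)}g_0$, where $\rho:\mathbb{R}\to\mathbb{R}$ is smooth and satisfies $\rho'(t)\ge\kappa$ for all $t$, for some constant $\kappa>0$. For an open set $\Omega\subset M$ put $$\lambda_{1,p}(\Omega)=\inf\left\{\frac{\int_\Omega\|\nabla u\|^p\,dM}{\int_\Omega|u|^p\,dM}\;:\;u\in W^{1,p}_0(\Omega),\ u\ne 0\right\}\in[0,\infty],$$ where $dM$ is the Riemannian volume and $W^{1,p}_0(\Omega)$ is the closure of $C_c^\infty(\Omega)$ in the $W^{1,p}$-norm. Then the fundamental tone $$\lambda_{1,p}(M)=\lim_{k\to\infty}\lambda_{1,p}(\Omega_k)$$ exists and is the same for every exhaustion $\Omega_1\subset\Omega_2\subset\cdots$ of $M$ by relatively compact open sets, and it satisfies $$\lambda_{1,p}(M)\ \ge\ \frac{(n-1)^p}{p^p}\,\kappa^p .$$ -/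

import Mathlib

open Bundle MeasureTheory Filter Set
open scoped Manifold ContDiff Topology ENNReal

noncomputable section

namespace PTone

section General

variable {E : Type*} [NormedAddCommGroup E] [NormedSpace ℝ E]
  {H : Type*} [TopologicalSpace H] {I : ModelWithCorners ℝ E H}
  {M : Type*} [TopologicalSpace M] [ChartedSpace H M] [IsManifold I ∞ M]

variable (I M) in
/-- Smooth Riemannian metrics on the smooth manifold `M`. -/
abbrev RiemMetric : Type _ :=
  ContMDiffRiemannianMetric I ∞ E (fun x : M => TangentSpace I x)

/-- The norm of a tangent vector. -/
def RiemMetric.norm (g : RiemMetric I M) (x : M) (v : TangentSpace I x) : ℝ :=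
  Real.sqrt (g.inner x v v)

/-- The inner product on the tangent space at `x`, as a bilinear form. -/
def RiemMetric.bilin (g : RiemMetric I M) (x : M) : LinearMap.BilinForm ℝ (TangentSpace I x) :=
  LinearMap.mk₂ ℝ (fun v w => g.inner x v w) (by simp) (by simp) (by simp) (by simp)

theorem RiemMetric.bilin_nondegenerate (g : RiemMetric I M) (x : M) : (g.bilin x).Nondegenerate := by
  constructor
  · intro v hv
    by_contra h
    exact (g.pos x v h).ne' (hv v)
  · intro v hv
    by_contra h
    exact (g.pos x v h).ne' (hv v)

instance [FiniteDimensional ℝ E] (x : M) : FiniteDimensional ℝ (TangentSpace I x) :=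
  inferInstanceAs (FiniteDimensional ℝ E)

/-- The Riemannian gradient: the vector `∇f(x)` with `⟨∇f(x), v⟩ = df_x(v)` for all `v`. -/
def RiemMetric.gradient [FiniteDimensional ℝ E] (g : RiemMetric I M) (f : M → ℝ) (x : M) :
    TangentSpace I x :=
  ((g.bilin x).toDual (g.bilin_nondegenerate x)).symm (mfderiv I 𝓘(ℝ, ℝ) f x).toLinearMap

theorem RiemMetric.inner_gradient [FiniteDimensional ℝ E] (g : RiemMetric I M) (f : M → ℝ) (x : M)
    (v : TangentSpace I x) :
    g.inner x (g.gradient f x) v = mfderiv I 𝓘(ℝ, ℝ) f x v :=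
  LinearMap.BilinForm.apply_toDual_symm_apply (hB := g.bilin_nondegenerate x) _ v

/-- The density `√det(g_ij)` of the Riemannian volume, at the point `y` of the image of the
preferred chart at `c`, where `g_ij = ⟨∂_i, ∂_j⟩` and the coordinates are taken with respect to
the basis `b` of the model space. -/
def RiemMetric.density {ι : Type*} [Fintype ι] [DecidableEq ι] (g : RiemMetric I M)
    (b : Module.Basis ι ℝ E) (c : M) (y : E) : ℝ :=
  Real.sqrt (Matrix.det (Matrix.of fun i j : ι =>
    g.inner ((extChartAt I c).symm y)
      (mfderiv 𝓘(ℝ, E) I (extChartAt I c).symm y (b i))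
      (mfderiv 𝓘(ℝ, E) I (extChartAt I c).symm y (b j))))

variable (H M) in
theorem exists_chart_centers [SecondCountableTopology M] [Nonempty M] :
    ∃ c : ℕ → M, ⋃ i, (chartAt H (c i)).source = univ := by
  obtain ⟨s, hs, hU⟩ := TopologicalSpace.countable_cover_nhds
    (f := fun x : M => (chartAt H x).source) (fun x => chart_source_mem_nhds H x)
  have hne : s.Nonempty := by
    rw [nonempty_iff_ne_empty]
    rintro rfl
    simp at hU
    exact (empty_ne_univ hU).elim
  obtain ⟨c, rfl⟩ := hs.exists_eq_range hne
  exact ⟨c, by simpa using hU⟩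

section Volume

variable [FiniteDimensional ℝ E] [MeasurableSpace E] [BorelSpace E] [MeasurableSpace M]

/-- The Riemannian volume of the domain of the preferred chart at `c`: the measure
`√det(g_ij) dy` on the image of the chart, transported to `M`. Here `dy` is the Lebesgue measure
normalised by the basis in which the `g_ij` are computed. -/
def RiemMetric.chartVolume (g : RiemMetric I M) (c : M) : Measure M :=
  (((Module.finBasis ℝ E).addHaar.restrict (extChartAt I c).target).withDensity
    (fun y => ENNReal.ofReal (g.density (Module.finBasis ℝ E) c y))).map (extChartAt I c).symm

/-- The Riemannian volume measure `dM`: choose countably many charts that cover `M`, cut their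
domains into disjoint pieces, and add up the volumes of the pieces, each computed in its chart. -/
def RiemMetric.volume [SecondCountableTopology M] [Nonempty M] (g : RiemMetric I M) : Measure M :=
  Measure.sum fun i : ℕ =>
    (g.chartVolume ((exists_chart_centers H M).choose i)).restrict
      (disjointed (fun j => (chartAt H ((exists_chart_centers H M).choose j)).source) i)

variable [SecondCountableTopology M] [Nonempty M]

/-- `φ` is a smooth function on `M` with compact support contained in `Ω`. -/
structure IsTestFunction (I : ModelWithCorners ℝ E H) (Ω : Set M) (φ : M → ℝ) : Prop where
  contMDiff : ContMDiff I 𝓘(ℝ, ℝ) ∞ φ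
  hasCompactSupport : HasCompactSupport φ
  tsupport_subset : tsupport φ ⊆ Ω

/-- `u ∈ W₀^{1,p}(Ω)` with weak gradient `X`: the pair `(u, X)` is in the closure of
`{(φ, ∇φ) : φ ∈ C_c^∞(Ω)}` in `L^p(Ω) × L^p(Ω; TM)`. (The field `X` is determined by `u` up to a
null set.) Only the values on `Ω` matter. -/
structure RiemMetric.MemW0 (g : RiemMetric I M) (p : ℝ) (Ω : Set M) (u : M → ℝ)
    (X : ∀ x : M, TangentSpace I x) : Prop where
  aemeasurable : AEMeasurable u (g.volume.restrict Ω)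
  aemeasurable_grad : @AEMeasurable M (TangentBundle I M) (borel _) _
    (fun x => (⟨x, X x⟩ : TangentBundle I M)) (g.volume.restrict Ω)
  lintegral_lt_top : ∫⁻ x in Ω, ENNReal.ofReal |u x| ^ p ∂g.volume < ⊤
  lintegral_grad_lt_top : ∫⁻ x in Ω, ENNReal.ofReal (g.norm x (X x)) ^ p ∂g.volume < ⊤
  exists_approx : ∃ φ : ℕ → M → ℝ, (∀ k, IsTestFunction I Ω (φ k)) ∧
    Tendsto (fun k => ∫⁻ x in Ω, ENNReal.ofReal |φ k x - u x| ^ p ∂g.volume) atTop (𝓝 0) ∧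
    Tendsto (fun k => ∫⁻ x in Ω,
      ENNReal.ofReal (g.norm x (g.gradient (φ k) x - X x)) ^ p ∂g.volume) atTop (𝓝 0)

/-- The first Dirichlet eigenvalue of the `p`-Laplacian on `Ω`: the infimum of
`∫_Ω ‖∇u‖^p / ∫_Ω |u|^p` over all `u ∈ W₀^{1,p}(Ω)`, `u ≠ 0`. -/
def RiemMetric.firstEigenvalue (g : RiemMetric I M) (p : ℝ) (Ω : Set M) : ℝ≥0∞ :=
  sInf {r | ∃ (u : M → ℝ) (X : ∀ x : M, TangentSpace I x), g.MemW0 p Ω u X ∧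
    ¬ u =ᵐ[g.volume.restrict Ω] 0 ∧
    r = (∫⁻ x in Ω, ENNReal.ofReal (g.norm x (X x)) ^ p ∂g.volume) /
      (∫⁻ x in Ω, ENNReal.ofReal |u x| ^ p ∂g.volume)}

/-- `Ω 0 ⊆ Ω 1 ⊆ …` is an exhaustion of `M` by relatively compact open sets. -/
structure IsExhaustion (Ω : ℕ → Set M) : Prop where
  isOpen : ∀ k, IsOpen (Ω k)
  isCompact_closure : ∀ k, IsCompact (closure (Ω k))
  monotone : Monotone Ω
  iUnion_eq : ⋃ k, Ω k = univ

/-- `L` is the fundamental tone of the `p`-Laplacian on `M`: the limit of the first eigenvalues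
along exhaustions of `M`, which exist and all give the same limit. -/
structure RiemMetric.IsFundamentalTone (g : RiemMetric I M) (p : ℝ) (L : ℝ≥0∞) : Prop where
  exists_exhaustion : ∃ Ω : ℕ → Set M, IsExhaustion Ω
  tendsto : ∀ Ω : ℕ → Set M, IsExhaustion Ω →
    Tendsto (fun k => g.firstEigenvalue p (Ω k)) atTop (𝓝 L)

end Volume

end General

section Pullback

variable {E : Type*} [NormedAddCommGroup E] [NormedSpace ℝ E]
  {H : Type*} [TopologicalSpace H] {I : ModelWithCorners ℝ E H}
  {N : Type*} [TopologicalSpace N] [ChartedSpace H N]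

theorem contMDiffAt_pullbackForm {F G : Type*} [NormedAddCommGroup F] [NormedSpace ℝ F]
    [NormedAddCommGroup G] [NormedSpace ℝ G] {q₀ : N}
    {B : N → F →L[ℝ] F →L[ℝ] ℝ} {D : N → G →L[ℝ] F}
    (hB : ContMDiffAt I 𝓘(ℝ, F →L[ℝ] F →L[ℝ] ℝ) ∞ B q₀)
    (hD : ContMDiffAt I 𝓘(ℝ, G →L[ℝ] F) ∞ D q₀) :
    ContMDiffAt I 𝓘(ℝ, G →L[ℝ] G →L[ℝ] ℝ) ∞
      (fun q => ((ContinuousLinearMap.compL ℝ G F ℝ).flip (D q)).comp ((B q).comp (D q))) q₀ := by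
  refine ContMDiffAt.clm_comp ?_ (hB.clm_comp hD)
  exact ContMDiffAt.comp (I' := 𝓘(ℝ, G →L[ℝ] F)) (g := (ContinuousLinearMap.compL ℝ G F ℝ).flip) q₀
    (ContinuousLinearMap.contDiff _).contMDiff.contMDiffAt hD

end Pullback

section Warped

variable {E : Type*} [NormedAddCommGroup E] [NormedSpace ℝ E]
  {H : Type*} [TopologicalSpace H] {I : ModelWithCorners ℝ E H}
  {N : Type*} [TopologicalSpace N] [ChartedSpace H N] [IsManifold I ∞ N]

/-- The bilinear form `((a, v), (b, w)) ↦ a b + c B(v, w)` on `ℝ × E`. -/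
def warpedForm (c : ℝ) (B : E →L[ℝ] E →L[ℝ] ℝ) : (ℝ × E) →L[ℝ] (ℝ × E) →L[ℝ] ℝ :=
  (ContinuousLinearMap.mul ℝ ℝ).bilinearComp
      (ContinuousLinearMap.fst ℝ ℝ E) (ContinuousLinearMap.fst ℝ ℝ E) +
    c • B.bilinearComp (ContinuousLinearMap.snd ℝ ℝ E) (ContinuousLinearMap.snd ℝ ℝ E)

theorem warpedForm_apply (c : ℝ) (B : E →L[ℝ] E →L[ℝ] ℝ) (v w : ℝ × E) :
    warpedForm c B v w = v.1 * w.1 + c * B v.2 w.2 := by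
  simp [warpedForm]

theorem warpedForm_symm (c : ℝ) {B : E →L[ℝ] E →L[ℝ] ℝ} (hB : ∀ v w, B v w = B w v)
    (v w : ℝ × E) : warpedForm c B v w = warpedForm c B w v := by
  rw [warpedForm_apply, warpedForm_apply, hB, mul_comm v.1]

theorem warpedForm_pos {c : ℝ} (hc : 0 < c) {B : E →L[ℝ] E →L[ℝ] ℝ}
    (hB : ∀ v, v ≠ 0 → 0 < B v v) (v : ℝ × E) (hv : v ≠ 0) : 0 < warpedForm c B v v := by
  rw [warpedForm_apply]
  by_cases h2 : v.2 = 0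
  · have h1 : v.1 ≠ 0 := fun h1 => hv (Prod.ext h1 h2)
    rw [h2, map_zero, mul_zero, add_zero]
    exact mul_self_pos.2 h1
  · exact add_pos_of_nonneg_of_pos (mul_self_nonneg _) (mul_pos hc (hB v.2 h2))

theorem warpedForm_isVonNBounded {c : ℝ} (hc : 0 < c) {B : E →L[ℝ] E →L[ℝ] ℝ}
    (hB : ∀ v, v ≠ 0 → 0 < B v v) (hb : Bornology.IsVonNBounded ℝ {v : E | B v v < 1}) :
    Bornology.IsVonNBounded ℝ {v : ℝ × E | warpedForm c B v v < 1} := by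
  obtain ⟨C, hC⟩ := ((NormedSpace.isVonNBounded_iff ℝ).1 hb).exists_norm_le
  obtain ⟨d, hd, rfl⟩ : ∃ d : ℝ, 0 < d ∧ c = d * d :=
    ⟨Real.sqrt c, Real.sqrt_pos.2 hc, (Real.mul_self_sqrt hc.le).symm⟩
  have hnn : ∀ v : E, 0 ≤ B v v := fun v => by
    by_cases h : v = 0
    · simp [h]
    · exact (hB v h).le
  refine (NormedSpace.isVonNBounded_iff ℝ).2
    (isBounded_iff_forall_norm_le.2 ⟨max 1 (d⁻¹ * C), ?_⟩)
  rintro ⟨a, v⟩ hv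
  simp only [mem_ofPred_eq, warpedForm_apply] at hv
  have h1 : |a| ≤ 1 := by
    rw [← sq_le_one_iff_abs_le_one]
    nlinarith [mul_nonneg hc.le (hnn v)]
  have h2 : ‖d • v‖ ≤ C := by
    refine hC (d • v) ?_
    simp only [mem_ofPred_eq, map_smul, smul_apply, smul_eq_mul]
    nlinarith [mul_self_nonneg a]
  rw [norm_smul, Real.norm_of_nonneg hd.le] at h2
  refine norm_prod_le_iff.2 ⟨by simpa using Or.inl h1, le_max_of_le_right ?_⟩
  rwa [le_inv_mul_iff₀ hd]

/-- The inner products of the warped metric `dt² + e^{2ρ(t)} g₀` on `ℝ × N`. The tangent space of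
`ℝ × N` at `(t, x)` is `ℝ × T_x N`. -/
def warpedInner (ρ : ℝ → ℝ) (g₀ : RiemMetric I N) (q : ℝ × N) :
    TangentSpace (𝓘(ℝ, ℝ).prod I) q →L[ℝ] TangentSpace (𝓘(ℝ, ℝ).prod I) q →L[ℝ] ℝ :=
  warpedForm (E := E) (Real.exp (2 * ρ q.1)) (g₀.inner q.2)

theorem warpedInner_contMDiff {ρ : ℝ → ℝ} (hρ : ContDiff ℝ ∞ ρ) (g₀ : RiemMetric I N) :
    ContMDiff (𝓘(ℝ, ℝ).prod I)
      ((𝓘(ℝ, ℝ).prod I).prod 𝓘(ℝ, (ℝ × E) →L[ℝ] (ℝ × E) →L[ℝ] ℝ)) ∞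
      (fun q : ℝ × N => TotalSpace.mk' ((ℝ × E) →L[ℝ] (ℝ × E) →L[ℝ] ℝ)
        (E := fun q : ℝ × N => TangentSpace (𝓘(ℝ, ℝ).prod I) q →L[ℝ]
          TangentSpace (𝓘(ℝ, ℝ).prod I) q →L[ℝ] ℝ) q (warpedInner ρ g₀ q)) := by
  intro q₀
  have hfst := ContMDiffAt.mfderiv_const (I := 𝓘(ℝ, ℝ).prod I) (H := ModelProd ℝ H) (I' := 𝓘(ℝ, ℝ)) (m := ∞) (n := ∞)
    (f := (Prod.fst : ℝ × N → ℝ)) (x₀ := q₀) contMDiffAt_fst (by simp)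
  have hsnd := ContMDiffAt.mfderiv_const (I := 𝓘(ℝ, ℝ).prod I) (I' := I) (m := ∞) (n := ∞)
    (f := (Prod.snd : ℝ × N → N)) (x₀ := q₀) contMDiffAt_snd (by simp)
  have hg := (contMDiffAt_hom_bundle _).1 (g₀.contMDiff.contMDiffAt (x := q₀.2))
  have hg2 := hg.2.comp q₀ (f := (Prod.snd : ℝ × N → N)) (I := 𝓘(ℝ, ℝ).prod I) contMDiffAt_snd
  have hexp : ContMDiffAt (𝓘(ℝ, ℝ).prod I) 𝓘(ℝ, ℝ) ∞
      (fun q : ℝ × N => Real.exp (2 * ρ q.1)) q₀ := by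
    have : ContDiff ℝ ∞ (fun t : ℝ => Real.exp (2 * ρ t)) := by fun_prop
    exact ContMDiffAt.comp (I' := 𝓘(ℝ, ℝ)) (g := fun t : ℝ => Real.exp (2 * ρ t)) q₀
      this.contMDiff.contMDiffAt contMDiffAt_fst
  rw [contMDiffAt_hom_bundle]
  refine ⟨contMDiffAt_id, ?_⟩
  have h1 := contMDiffAt_pullbackForm (contMDiffAt_const (c := ContinuousLinearMap.mul ℝ ℝ)) hfst
  have h2 := hexp.smul (contMDiffAt_pullbackForm hg2 hsnd)
  refine (h1.add h2).congr_of_eventuallyEq ?_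
  have hq : ∀ᶠ q in 𝓝 q₀,
      q ∈ (trivializationAt (ℝ × E) (TangentSpace (𝓘(ℝ, ℝ).prod I)) q₀).baseSet :=
    (trivializationAt (ℝ × E) (TangentSpace (𝓘(ℝ, ℝ).prod I)) q₀).open_baseSet.mem_nhds
      (FiberBundle.mem_baseSet_trivializationAt' q₀)
  have hq2 : ∀ᶠ q in 𝓝 q₀, q.2 ∈ (trivializationAt E (TangentSpace I) q₀.2).baseSet :=
    continuous_snd.continuousAt.eventually
      ((trivializationAt E (TangentSpace I) q₀.2).open_baseSet.mem_nhds
        (FiberBundle.mem_baseSet_trivializationAt' q₀.2))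
  filter_upwards [hq, hq2] with q hq hq2
  refine ContinuousLinearMap.ext fun v => ContinuousLinearMap.ext fun w => ?_
  have hq1 : q.1 ∈ (trivializationAt ℝ (TangentSpace 𝓘(ℝ, ℝ)) q₀.1).baseSet := by
    rw [TangentBundle.trivializationAt_baseSet, chartAt_self_eq]
    trivial
  set T := trivializationAt (ℝ × E) (TangentSpace (𝓘(ℝ, ℝ).prod I)) q₀
  set T₂ := trivializationAt E (TangentSpace I) q₀.2
  have e1 : ∀ v : ℝ × E, inTangentCoordinates (𝓘(ℝ, ℝ).prod I) 𝓘(ℝ, ℝ) id Prod.fst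
      (mfderiv (𝓘(ℝ, ℝ).prod I) 𝓘(ℝ, ℝ) (Prod.fst : ℝ × N → ℝ)) q₀ q v =
      ((T.symm q v : TangentSpace (𝓘(ℝ, ℝ).prod I) q) : ℝ × E).1 := by
    intro v
    refine (congrArg (fun L => L v) (ContinuousLinearMap.inCoordinates_eq
      (ϕ := mfderiv (𝓘(ℝ, ℝ).prod I) 𝓘(ℝ, ℝ) (Prod.fst : ℝ × N → ℝ) q) hq hq1)).trans ?_
    rw [mfderiv_fst]
    refine (congrFun (Trivialization.coe_continuousLinearEquivAt_eq
      (R := ℝ) (trivializationAt ℝ (TangentSpace 𝓘(ℝ, ℝ)) q₀.1) hq1) _).trans ?_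
    refine (congrArg (fun L : ℝ →L[ℝ] ℝ => L _)
      (TangentBundle.continuousLinearMapAt_model_space (𝕜 := ℝ) (F := ℝ) q₀.1 q.1)).trans ?_
    rfl
  have e2 : ∀ v : ℝ × E, T₂.symm q.2 (inTangentCoordinates (𝓘(ℝ, ℝ).prod I) I id Prod.snd
      (mfderiv (𝓘(ℝ, ℝ).prod I) I (Prod.snd : ℝ × N → N)) q₀ q v) =
      ((T.symm q v : TangentSpace (𝓘(ℝ, ℝ).prod I) q) : ℝ × E).2 := by
    intro v
    refine (congrArg (fun L => T₂.symm q.2 (L v)) (ContinuousLinearMap.inCoordinates_eq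
      (ϕ := mfderiv (𝓘(ℝ, ℝ).prod I) I (Prod.snd : ℝ × N → N) q) hq hq2)).trans ?_
    rw [mfderiv_snd]
    exact (T₂.continuousLinearEquivAt ℝ q.2 hq2).symm_apply_apply _
  have hL : ContinuousLinearMap.inCoordinates (ℝ × E) (TangentSpace (𝓘(ℝ, ℝ).prod I))
      ((ℝ × E) →L[ℝ] ℝ) (fun b => TangentSpace (𝓘(ℝ, ℝ).prod I) b →L[ℝ] ℝ) q₀ q q₀ q
      (warpedInner ρ g₀ q) v w = warpedInner ρ g₀ q (T.symm q v) (T.symm q w) := by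
    rw [inCoordinates_apply_eq₂ hq hq (by simp)]
    simp [T]
  have hR : ∀ v w : E, ContinuousLinearMap.inCoordinates E (TangentSpace I)
      (E →L[ℝ] ℝ) (fun b => TangentSpace I b →L[ℝ] ℝ) q₀.2 q.2 q₀.2 q.2 (g₀.inner q.2) v w =
      g₀.inner q.2 (T₂.symm q.2 v) (T₂.symm q.2 w) := by
    intro v w
    rw [inCoordinates_apply_eq₂ hq2 hq2 (by simp)]
    simp [T₂]
  refine hL.trans ?_
  refine Eq.trans ?_ (congrArg₂ (· + ·) rfl (congrArg (Real.exp (2 * ρ q.1) * ·) (hR _ _))).symm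
  refine (warpedForm_apply (E := E) _ _ _ _).trans ?_
  exact congrArg₂ (· + ·) (congrArg₂ (· * ·) (e1 v).symm (e1 w).symm)
    (congrArg (Real.exp (2 * ρ q.1) * ·)
      (congrArg₂ (fun a b : TangentSpace I q.2 => g₀.inner q.2 a b) (e2 v).symm (e2 w).symm))

/-- The warped product metric `dt² + e^{2ρ(t)} g₀` on `ℝ × N`. -/
def warpedMetric {ρ : ℝ → ℝ} (hρ : ContDiff ℝ ∞ ρ) (g₀ : RiemMetric I N) :
    RiemMetric (𝓘(ℝ, ℝ).prod I) (ℝ × N) where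
  inner := warpedInner ρ g₀
  symm q := warpedForm_symm (E := E) _ (g₀.symm q.2)
  pos q := warpedForm_pos (E := E) (Real.exp_pos _) (g₀.pos q.2)
  isVonNBounded q :=
    warpedForm_isVonNBounded (E := E) (Real.exp_pos _) (g₀.pos q.2) (g₀.isVonNBounded q.2)
  contMDiff := warpedInner_contMDiff hρ g₀

end Warped

end PTone

end

namespace PTone

/-! Only the radial derivative matters. The field `∂_t` is a unit field orthogonal to the fibres, so
`|∂_t u| ≤ ‖∇u‖`, and in a product chart the volume is `e^{(n-1)ρ(t)} dt` times a measure in the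
fibre variable. The bound thus reduces to a Hardy inequality on each line `ℝ × {x}` with weight `w =
e^{(n-1)ρ}`. Since `w' ≥ (n-1)κ w`, integrating `(|f|^p w)'` over the line and applying Young's
inequality gives `∫ w |f'|^p ≥ c^p ∫ w |f|^p` with `c = (n-1)κ/p` (`weighted_hardy`). Fubini
(`lintegral_warpedMetric_mono`) integrates this over the fibre, and `lintegral_rpow_le_of_approx`
carries it from test functions to `W₀^{1,p}`. Every open `Ω` obeys the same bound, hence so does the
limit.

The limit exists because eigenvalues decrease as the domain grows (`firstEigenvalue_anti`). It is
independent of the exhaustion because, by compactness, each member of one exhaustion lies in a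
member of any other. -/

/-! ### Hardy's inequality on the line -/

theorem young_rpow {p a b : ℝ} (hp : 1 < p) (ha : 0 ≤ a) (hb : 0 ≤ b) :
    p * a ^ (p - 1) * b ≤ (p - 1) * a ^ p + b ^ p := by
  have hp0 : 0 < p := by linarith
  have hpq := Real.HolderConjugate.conjExponent hp
  have h := Real.young_inequality_of_nonneg hb (Real.rpow_nonneg ha (p - 1)) hpq
  have e : (a ^ (p - 1)) ^ Real.conjExponent p = a ^ p := by
    rw [← Real.rpow_mul ha, Real.conjExponent]
    congr 1
    field_simp [(by linarith : p - 1 ≠ 0)]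
  rw [e, Real.conjExponent] at h
  have h2 := mul_le_mul_of_nonneg_left h hp0.le
  have h3 : p * (b ^ p / p + a ^ p / (p / (p - 1))) = (p - 1) * a ^ p + b ^ p := by
    field_simp
    ring
  linarith [h2, h3]

/-- A weighted Hardy inequality on the line, for weights of exponential growth. -/
theorem weighted_hardy {p c : ℝ} (hp : 1 < p) (hc : 0 ≤ c) {w f : ℝ → ℝ}
    (hw : ContDiff ℝ 1 w) (hw0 : ∀ t, 0 ≤ w t) (hw' : ∀ t, p * c * w t ≤ deriv w t)
    (hf : ContDiff ℝ 1 f) (hfc : HasCompactSupport f) :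
    ∫ t, w t * (c ^ p * |f t| ^ p) ≤ ∫ t, w t * |deriv f t| ^ p := by
  have hp0 : 0 < p := by linarith
  have hwd : ∀ t, HasDerivAt w (deriv w t) t := fun t =>
    (hw.differentiable (by simp) t).hasDerivAt
  have hfd : ∀ t, HasDerivAt f (deriv f t) t := fun t =>
    (hf.differentiable (by simp) t).hasDerivAt
  have hfc' : HasCompactSupport (deriv f) := hfc.deriv
  have hcf : Continuous f := hf.continuous
  have hcw : Continuous w := hw.continuous
  have hcf' : Continuous (deriv f) := hf.continuous_deriv le_rfl
  have hca : Continuous fun t => |f t| ^ p := hcf.abs.rpow_const fun _ => Or.inr hp0.le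
  have habs : ∀ t, |(|f t| ^ (p - 2) * f t)| = |f t| ^ (p - 1) := fun t => by
    rw [abs_mul, abs_of_nonneg (Real.rpow_nonneg (abs_nonneg _) _)]
    rcases eq_or_ne (f t) 0 with h | h
    · simp [h, Real.zero_rpow (by linarith : p - 1 ≠ 0)]
    · rw [← Real.rpow_add_one (abs_pos.2 h).ne']; congr 1; ring
  -- The total derivative of `|f|^p w` integrates to zero. Its first term is at least `-p |f|^(p-1)
  -- |f'| w` and its second at least `p c w |f|^p`.
  have hG : ∀ t, HasDerivAt (fun t => |f t| ^ p * w t)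
      (p * |f t| ^ (p - 2) * f t * deriv f t * w t + |f t| ^ p * deriv w t) t := fun t =>
    ((hasDerivAt_abs_rpow (f t) hp).comp t (hfd t)).mul (hwd t)
  have hcG : Continuous fun t => |f t| ^ p * w t := hca.mul hcw
  have hz : ∀ t, f t = 0 → |f t| ^ p = 0 := fun t h => by simp [h, Real.zero_rpow hp0.ne']
  have hsG : HasCompactSupport fun t => |f t| ^ p * w t :=
    hfc.mono fun t ht h => ht (by simp [hz t h])
  have hGC : ContDiff ℝ 1 fun t => |f t| ^ p * w t := by
    refine ContDiff.mul ?_ hw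
    have : ContDiff ℝ 1 fun t => ‖f t‖ ^ p := (hf.norm_rpow hp)
    simpa using this
  have hdG : ∀ t, deriv (fun t => |f t| ^ p * w t) t =
      p * |f t| ^ (p - 2) * f t * deriv f t * w t + |f t| ^ p * deriv w t := fun t => (hG t).deriv
  have hcdG := hGC.continuous_deriv le_rfl
  have hsdG := hsG.deriv
  have hidG : Integrable (deriv fun t => |f t| ^ p * w t) :=
    hcdG.integrable_of_hasCompactSupport hsdG
  have hint0 : ∫ t, deriv (fun t => |f t| ^ p * w t) t = 0 :=
    integral_eq_zero_of_hasDerivAt_of_integrable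
      (fun t => (hGC.differentiable (by simp) t).hasDerivAt) hidG (hcG.integrable_of_hasCompactSupport hsG)
  have hi1 : Integrable fun t => w t * (c ^ p * |f t| ^ p) :=
    (hcw.mul (continuous_const.mul hca)).integrable_of_hasCompactSupport
      (hfc.mono fun t ht h => ht (by simp [hz t h]))
  have hi2 : Integrable fun t => w t * |deriv f t| ^ p :=
    (hcw.mul (hcf'.abs.rpow_const fun _ => Or.inr hp0.le)).integrable_of_hasCompactSupport
      (hfc'.mono fun t ht h => ht (by simp [h, Real.zero_rpow hp0.ne']))
  -- The factor `c^(p-1)` makes the cross term `p (c|f|)^(p-1) |f'|`, so that Young's inequality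
  -- with `a = c|f|`, `b = |f'|` consumes `p - 1` of the `p` copies of `c^p |f|^p` and leaves one.
  have hle : ∀ t, w t * (c ^ p * |f t| ^ p) - w t * |deriv f t| ^ p ≤
      c ^ (p - 1) * deriv (fun t => |f t| ^ p * w t) t := fun t => by
    rw [hdG]
    have hcp : c ^ p = c ^ (p - 1) * c := by
      rcases hc.eq_or_lt with h | h
      · simp [← h, Real.zero_rpow hp0.ne']
      · rw [← Real.rpow_add_one h.ne']; congr 1; ring
    have hy := young_rpow hp (mul_nonneg hc (abs_nonneg (f t))) (abs_nonneg (deriv f t))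
    rw [Real.mul_rpow hc (abs_nonneg _), Real.mul_rpow hc (abs_nonneg _)] at hy
    have h1 : -(|f t| ^ (p - 1) * |deriv f t|) ≤ |f t| ^ (p - 2) * f t * deriv f t := by
      rw [← habs t, ← abs_mul]; exact neg_abs_le _
    have hC : 0 ≤ c ^ (p - 1) := Real.rpow_nonneg hc _
    have hA : 0 ≤ |f t| ^ p := Real.rpow_nonneg (abs_nonneg _) _
    have h2 := mul_le_mul_of_nonneg_left (hw' t) (mul_nonneg hC hA)
    have h3 := mul_le_mul_of_nonneg_left h1 (mul_nonneg (mul_nonneg hC hp0.le) (hw0 t))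
    have h4 := mul_le_mul_of_nonneg_left hy (hw0 t)
    rw [hcp] at h4 ⊢
    nlinarith [h2, h3, h4]
  have := integral_mono (hi1.sub hi2) (hidG.const_mul _) hle
  simp only [Pi.sub_apply] at this
  rw [integral_sub hi1 hi2, integral_const_mul, hint0] at this
  linarith

theorem weighted_hardy_lintegral {p c : ℝ} (hp : 1 < p) (hc : 0 ≤ c) {w f : ℝ → ℝ}
    (hw : ContDiff ℝ 1 w) (hw0 : ∀ t, 0 ≤ w t) (hw' : ∀ t, p * c * w t ≤ deriv w t)
    (hf : ContDiff ℝ 1 f) (hfc : HasCompactSupport f) :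
    ENNReal.ofReal (c ^ p) * ∫⁻ t, ENNReal.ofReal (w t) * ENNReal.ofReal |f t| ^ p ≤
      ∫⁻ t, ENNReal.ofReal (w t) * ENNReal.ofReal |deriv f t| ^ p := by
  have hp0 : 0 < p := by linarith
  have hcw : Continuous w := hw.continuous
  have hcf : Continuous f := hf.continuous
  have hcf' : Continuous (deriv f) := hf.continuous_deriv le_rfl
  have hi1 : Integrable fun t => w t * (c ^ p * |f t| ^ p) :=
    (hcw.mul (continuous_const.mul (hcf.abs.rpow_const fun _ => Or.inr hp0.le)))
      |>.integrable_of_hasCompactSupport (hfc.mono fun t ht h => ht (by simp [h, Real.zero_rpow hp0.ne']))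
  have hi2 : Integrable fun t => w t * |deriv f t| ^ p :=
    (hcw.mul (hcf'.abs.rpow_const fun _ => Or.inr hp0.le)).integrable_of_hasCompactSupport
      (hfc.deriv.mono fun t ht h => ht (by simp [h, Real.zero_rpow hp0.ne']))
  have hc' : 0 ≤ c ^ p := Real.rpow_nonneg hc _
  rw [← lintegral_const_mul' _ _ ENNReal.ofReal_ne_top]
  have e1 : ∀ t, ENNReal.ofReal (c ^ p) * (ENNReal.ofReal (w t) * ENNReal.ofReal |f t| ^ p) =
      ENNReal.ofReal (w t * (c ^ p * |f t| ^ p)) := fun t => by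
    rw [ENNReal.ofReal_mul (hw0 t), ENNReal.ofReal_mul hc',
      ENNReal.ofReal_rpow_of_nonneg (abs_nonneg _) hp0.le]
    ring
  have e2 : ∀ t, ENNReal.ofReal (w t) * ENNReal.ofReal |deriv f t| ^ p =
      ENNReal.ofReal (w t * |deriv f t| ^ p) := fun t => by
    rw [ENNReal.ofReal_mul (hw0 t), ENNReal.ofReal_rpow_of_nonneg (abs_nonneg _) hp0.le]
  simp_rw [e1, e2]
  rw [← ofReal_integral_eq_lintegral_ofReal hi1 (Eventually.of_forall fun t =>
      mul_nonneg (hw0 t) (mul_nonneg hc' (Real.rpow_nonneg (abs_nonneg _) _))),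
    ← ofReal_integral_eq_lintegral_ofReal hi2 (Eventually.of_forall fun t =>
      mul_nonneg (hw0 t) (Real.rpow_nonneg (abs_nonneg _) _))]
  exact ENNReal.ofReal_le_ofReal (weighted_hardy hp hc hw hw0 hw' hf hfc)

/-! ### Extension by zero, monotonicity and existence of the fundamental tone -/

theorem lintegral_eq_of_eq_zero_off {M : Type*} [MeasurableSpace M] {μ : Measure M} {f : M → ℝ≥0∞}
    {Ω Ω' : Set M}
    (hΩ : MeasurableSet Ω) (h : Ω ⊆ Ω') (hf : ∀ x ∉ Ω, f x = 0) :
    ∫⁻ x in Ω', f x ∂μ = ∫⁻ x in Ω, f x ∂μ := by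
  have : f = Ω.indicator f := by
    ext x
    by_cases hx : x ∈ Ω
    · simp [hx]
    · simp [hx, hf x hx]
  rw [this, lintegral_indicator hΩ, lintegral_indicator hΩ, Measure.restrict_restrict hΩ,
    inter_eq_left.2 h, Measure.restrict_restrict hΩ, inter_self]

theorem lintegral_rpow_extend {M : Type*} [MeasurableSpace M] {μ : Measure M} {p : ℝ} (hp : 0 < p)
    {f f' : M → ℝ} {Ω Ω' : Set M}
    (hΩ : MeasurableSet Ω) (h : Ω ⊆ Ω') (hf : ∀ x ∉ Ω, f' x = 0) (he : ∀ x ∈ Ω, f' x = f x) :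
    ∫⁻ x in Ω', ENNReal.ofReal (f' x) ^ p ∂μ = ∫⁻ x in Ω, ENNReal.ofReal (f x) ^ p ∂μ := by
  rw [lintegral_eq_of_eq_zero_off hΩ h fun x hx => by simp [hf x hx, hp]]
  exact setLIntegral_congr_fun hΩ fun x hx => by simp only [he x hx]

theorem IsExhaustion.exists_subset {M : Type*} [TopologicalSpace M] {Ω : ℕ → Set M}
    (h : IsExhaustion Ω) {K : Set M}
    (hK : IsCompact K) : ∃ k, K ⊆ Ω k :=
  hK.elim_directed_cover Ω h.isOpen (by simp [h.iUnion_eq]) h.monotone.directed_le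

theorem exists_isExhaustion {M : Type*} [TopologicalSpace M] [SecondCountableTopology M] [T2Space M]
    [WeaklyLocallyCompactSpace M] :
    ∃ Ω : ℕ → Set M, IsExhaustion Ω := by
  let K := CompactExhaustion.choice M
  refine ⟨fun k => interior (K k), fun k => isOpen_interior, fun k => ?_, fun i j hij => ?_, ?_⟩
  · exact (K.isCompact k).of_isClosed_subset isClosed_closure
      (closure_minimal interior_subset (K.isCompact k).isClosed)
  · exact interior_mono (K.subset hij)
  · refine eq_univ_of_forall fun x => ?_
    obtain ⟨k, hk⟩ := K.exists_mem x
    -- A point of `K k` need only be interior to the next compact set, hence the shift.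
    exact mem_iUnion.2 ⟨k + 1, K.subset_interior_succ k hk⟩

section General

variable {E : Type*} [NormedAddCommGroup E] [NormedSpace ℝ E]
  {H : Type*} [TopologicalSpace H] {I : ModelWithCorners ℝ E H}
  {M : Type*} [TopologicalSpace M] [ChartedSpace H M]

theorem mfderiv_eq_zero_of_notMem_tsupport {φ : M → ℝ} {x : M} (hx : x ∉ tsupport φ) :
    mfderiv I 𝓘(ℝ, ℝ) φ x = 0 := by
  have h : φ =ᶠ[𝓝 x] fun _ => 0 := notMem_tsupport_iff_eventuallyEq.1 hx
  rw [h.mfderiv_eq]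
  exact mfderiv_const

variable [IsManifold I ∞ M]

@[simp]
theorem RiemMetric.norm_zero (g : RiemMetric I M) (x : M) : g.norm x 0 = 0 := by
  simp [RiemMetric.norm]

theorem RiemMetric.gradient_eq_zero_of_notMem_tsupport [FiniteDimensional ℝ E]
    (g : RiemMetric I M) {φ : M → ℝ} {x : M} (hx : x ∉ tsupport φ) : g.gradient φ x = 0 := by
  by_contra h
  have h1 := g.pos x _ h
  rw [g.inner_gradient, mfderiv_eq_zero_of_notMem_tsupport hx] at h1
  exact lt_irrefl _ h1

variable [FiniteDimensional ℝ E] [MeasurableSpace E] [BorelSpace E] [MeasurableSpace M]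
  [BorelSpace M] [SecondCountableTopology M] [Nonempty M]

open Classical in
/-- Functions in `W₀^{1,p}(Ω)` extend by zero. -/
theorem RiemMetric.MemW0.extend {g : RiemMetric I M} {p : ℝ} (hp : 0 < p) {Ω Ω' : Set M}
    (hΩ : IsOpen Ω) (hΩ' : IsOpen Ω') (h : Ω ⊆ Ω') {u : M → ℝ} {X : ∀ x : M, TangentSpace I x}
    (hu : g.MemW0 p Ω u X) :
    g.MemW0 p Ω' (fun x => if x ∈ Ω then u x else 0) (fun x => if x ∈ Ω then X x else 0) := by
  have hunion : Ω' = Ω ∪ (Ω' \ Ω) := (union_sdiff_cancel h).symm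
  constructor
  · rw [hunion, aemeasurable_union_iff]
    constructor
    · exact hu.aemeasurable.congr ((ae_restrict_iff' hΩ.measurableSet).2
        (Eventually.of_forall fun x hx => by simp [hx]))
    · exact (aemeasurable_const (b := (0 : ℝ))).congr
        ((ae_restrict_iff' (hΩ'.measurableSet.diff hΩ.measurableSet)).2
        (Eventually.of_forall fun x hx => by simp [hx.2]))
  · let : MeasurableSpace (TangentBundle I M) := borel _
    have : BorelSpace (TangentBundle I M) := ⟨rfl⟩
    rw [hunion, aemeasurable_union_iff]
    constructor
    · exact hu.aemeasurable_grad.congr ((ae_restrict_iff' hΩ.measurableSet).2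
        (Eventually.of_forall fun x hx => by simp [hx]))
    -- Off `Ω` the extended field is the zero section, which is measurable into the tangent bundle
    -- because it is continuous.
    · have hz : Continuous fun x : M => (⟨x, 0⟩ : TangentBundle I M) :=
        (Bundle.contMDiff_zeroSection ℝ (IB := I) (n := 0) (F := E)
          (TangentSpace I : M → Type _)).continuous
      exact hz.measurable.aemeasurable.congr
        ((ae_restrict_iff' (hΩ'.measurableSet.diff hΩ.measurableSet)).2
        (Eventually.of_forall fun x hx => by simp [hx.2]))
  · rw [lintegral_rpow_extend hp hΩ.measurableSet h (f := fun x => |u x|)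
      (fun x hx => by simp [hx]) (fun x hx => by simp [hx])]
    exact hu.lintegral_lt_top
  · rw [lintegral_rpow_extend hp hΩ.measurableSet h (f := fun x => g.norm x (X x))
      (fun x hx => by simp [hx]) (fun x hx => by simp [hx])]
    exact hu.lintegral_grad_lt_top
  · obtain ⟨φ, hφ, h1, h2⟩ := hu.exists_approx
    -- The same test functions serve: they and their gradients vanish off `Ω`, so neither error
    -- integral changes.
    refine ⟨φ, fun k => ⟨(hφ k).1, (hφ k).2, (hφ k).3.trans h⟩, ?_, ?_⟩
    · refine h1.congr fun k => ?_
      rw [lintegral_rpow_extend hp hΩ.measurableSet h (f := fun x => |φ k x - u x|)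
        (fun x hx => ?_) (fun x hx => by simp [hx])]
      simp [hx, image_eq_zero_of_notMem_tsupport fun hh => hx ((hφ k).3 hh)]
    · refine h2.congr fun k => ?_
      rw [lintegral_rpow_extend hp hΩ.measurableSet h
        (f := fun x => g.norm x (g.gradient (φ k) x - X x))
        (fun x hx => ?_) (fun x hx => by simp [hx])]
      simp [hx, g.gradient_eq_zero_of_notMem_tsupport fun hh => hx ((hφ k).3 hh)]

/-- Extension by zero preserves both integrals, so every Rayleigh quotient on the smaller set is
also one on the larger set. -/
theorem RiemMetric.firstEigenvalue_anti (g : RiemMetric I M) {p : ℝ} (hp : 0 < p) {Ω Ω' : Set M}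
    (hΩ : IsOpen Ω) (hΩ' : IsOpen Ω') (h : Ω ⊆ Ω') :
    g.firstEigenvalue p Ω' ≤ g.firstEigenvalue p Ω := by
  classical
  refine sInf_le_sInf ?_
  rintro r ⟨u, X, hu, hne, rfl⟩
  refine ⟨_, _, hu.extend hp hΩ hΩ' h, fun h0 => hne ?_, ?_⟩
  · have h1 := ae_restrict_of_ae_restrict_of_subset h h0
    filter_upwards [h1, ae_restrict_mem hΩ.measurableSet] with x hx hxΩ
    simpa [hxΩ] using hx
  · congr 1
    · exact (lintegral_rpow_extend hp hΩ.measurableSet h (fun x hx => by simp [hx])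
        (fun x hx => by simp [hx])).symm
    · exact (lintegral_rpow_extend hp hΩ.measurableSet h (fun x hx => by simp [hx])
        (fun x hx => by simp [hx])).symm

/-- The fundamental tone exists as soon as some exhaustion does. -/
theorem RiemMetric.isFundamentalTone_iInf (g : RiemMetric I M) {p : ℝ} (hp : 0 < p)
    {Ω : ℕ → Set M} (h : IsExhaustion Ω) :
    g.IsFundamentalTone p (⨅ k, g.firstEigenvalue p (Ω k)) := by
  -- The closure of each `Ω₂ k` is compact, hence inside some `Ω₁ m`. Exchanging the two exhaustions
  -- gives equality of the infima.
  have key : ∀ Ω₁ Ω₂ : ℕ → Set M, IsExhaustion Ω₁ → IsExhaustion Ω₂ →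
      ⨅ k, g.firstEigenvalue p (Ω₁ k) ≤ ⨅ k, g.firstEigenvalue p (Ω₂ k) := by
    intro Ω₁ Ω₂ h₁ h₂
    refine le_iInf fun k => ?_
    obtain ⟨m, hm⟩ := h₁.exists_subset (h₂.isCompact_closure k)
    exact (iInf_le _ m).trans
      (g.firstEigenvalue_anti hp (h₂.isOpen k) (h₁.isOpen m) (subset_closure.trans hm))
  refine ⟨⟨Ω, h⟩, fun Ω' h' => ?_⟩
  rw [(key Ω Ω' h h').antisymm (key Ω' Ω h' h)]
  exact tendsto_atTop_iInf fun i j hij =>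
    g.firstEigenvalue_anti hp (h'.isOpen i) (h'.isOpen j) (h'.monotone hij)

end General

/-! ### Gram determinants and continuity of metric coefficients -/

section Density

variable {E : Type*} [NormedAddCommGroup E] [NormedSpace ℝ E]

/-- Scaling the fibre part of the form by `s ^ 2` is pullback along `id × s`, whose determinant is
`s ^ finrank E`. The basis is arbitrary because the density on `ℝ × E` is computed in a basis that
need not be adapted to the product. -/
theorem det_warped [FiniteDimensional ℝ E] {ι : Type*} [Fintype ι] [DecidableEq ι]
    (b : Module.Basis ι ℝ (ℝ × E)) (B : LinearMap.BilinForm ℝ E) (a s : ℝ) :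
    Matrix.det (Matrix.of fun i j => (b i).1 * (b j).1 + s ^ 2 * a * B (b i).2 (b j).2) =
      (s ^ Module.finrank ℝ E) ^ 2 *
        Matrix.det (Matrix.of fun i j => (b i).1 * (b j).1 + a * B (b i).2 (b j).2) := by
  let W : LinearMap.BilinForm ℝ (ℝ × E) :=
    (LinearMap.mul ℝ ℝ).compl₁₂ (LinearMap.fst ℝ ℝ E) (LinearMap.fst ℝ ℝ E) +
      a • B.compl₁₂ (LinearMap.snd ℝ ℝ E) (LinearMap.snd ℝ ℝ E)
  let A : (ℝ × E) →ₗ[ℝ] (ℝ × E) := LinearMap.prodMap LinearMap.id (s • LinearMap.id)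
  have e1 : (Matrix.of fun i j => (b i).1 * (b j).1 + s ^ 2 * a * B (b i).2 (b j).2) =
      LinearMap.BilinForm.toMatrix b (W.comp A A) := by
    ext i j
    simp [LinearMap.BilinForm.toMatrix_apply, W, A]
    ring
  have e2 : (Matrix.of fun i j => (b i).1 * (b j).1 + a * B (b i).2 (b j).2) =
      LinearMap.BilinForm.toMatrix b W := by
    ext i j
    simp [LinearMap.BilinForm.toMatrix_apply, W]
  have hA : LinearMap.det A = s ^ Module.finrank ℝ E := by
    simp [A, LinearMap.det_prodMap, LinearMap.det_smul]
  rw [e1, e2, LinearMap.BilinForm.toMatrix_comp b b, Matrix.det_mul, Matrix.det_mul,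
    Matrix.det_transpose, LinearMap.det_toMatrix, hA]
  ring

variable {H : Type*} [TopologicalSpace H] {I : ModelWithCorners ℝ E H} [I.Boundaryless]
  {N : Type*} [TopologicalSpace N] [ChartedSpace H N] [IsManifold I ∞ N]

/-- The tangent map of the inverse chart carries constant fields to continuous ones, and the metric
is continuous on the bundle. This supplies measurability of the density for Fubini. -/
theorem RiemMetric.continuousOn_inner_chart (g : RiemMetric I N) (c : N) (v w : E) :
    ContinuousOn (fun y : E => g.inner ((extChartAt I c).symm y)
      (mfderiv 𝓘(ℝ, E) I (extChartAt I c).symm y v)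
      (mfderiv 𝓘(ℝ, E) I (extChartAt I c).symm y w)) (extChartAt I c).target := by
  let : RiemannianBundle (fun x : N => TangentSpace I x) := ⟨g.toRiemannianMetric⟩
  have : IsContinuousRiemannianBundle E (fun x : N => TangentSpace I x) :=
    ⟨g.inner, g.contMDiff.continuous, fun _ _ _ => rfl⟩
  have hopen := isOpen_extChartAt_target (I := I) c
  have h : ∀ v : E, ContinuousOn (fun y : E => (⟨(extChartAt I c).symm y,
      mfderiv 𝓘(ℝ, E) I (extChartAt I c).symm y v⟩ : TangentBundle I N))
      (extChartAt I c).target := by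
    intro v
    have h1 := (contMDiffOn_extChartAt_symm (I := I) (n := ∞) c).continuousOn_tangentMapWithin
      (by simp) hopen.uniqueMDiffOn
    have h2 : Continuous fun y : E => (⟨y, v⟩ : TangentBundle 𝓘(ℝ, E) E) :=
      (tangentBundleModelSpaceHomeomorph 𝓘(ℝ, E)).symm.continuous.comp
        (continuous_id.prodMk continuous_const : Continuous fun y : E => (y, v))
    refine (h1.comp h2.continuousOn (fun y hy => hy)).congr fun y hy => ?_
    simp only [Function.comp, tangentMapWithin]
    rw [mfderivWithin_of_isOpen hopen hy]
  exact ContinuousOn.inner_bundle (F := E) (h v) (h w)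

end Density

/-! ### Product charts -/

section Product

variable {E : Type*} [NormedAddCommGroup E] [NormedSpace ℝ E]
  {H : Type*} [TopologicalSpace H] {I : ModelWithCorners ℝ E H}
  {N : Type*} [TopologicalSpace N] [ChartedSpace H N]

theorem extChartAt_symm_real_prod (c : ℝ × N) (y : ℝ × E) :
    (extChartAt (𝓘(ℝ, ℝ).prod I) c).symm y = (y.1, (extChartAt I c.2).symm y.2) := by
  rw [extChartAt_prod]
  simp [chartAt_self_eq]

theorem extChartAt_target_real_prod (c : ℝ × N) :
    (extChartAt (𝓘(ℝ, ℝ).prod I) c).target = univ ×ˢ (extChartAt I c.2).target := by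
  rw [extChartAt_prod]
  simp [chartAt_self_eq]

theorem mfderiv_extChartAt_symm_real_prod [IsManifold I ∞ N] [I.Boundaryless] (c : ℝ × N)
    {y : ℝ × E} (hy : y.2 ∈ (extChartAt I c.2).target) (v : ℝ × E) :
    (mfderiv 𝓘(ℝ, ℝ × E) (𝓘(ℝ, ℝ).prod I) (extChartAt (𝓘(ℝ, ℝ).prod I) c).symm y v : ℝ × E) =
      (v.1, (mfderiv 𝓘(ℝ, E) I (extChartAt I c.2).symm y.2 v.2 : E)) := by
  have hI : IsManifold I 1 N := IsManifold.of_le (n := ∞) (by simp)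
  have hs : MDifferentiableAt 𝓘(ℝ, E) I (extChartAt I c.2).symm y.2 :=
    (mdifferentiableOn_extChartAt_symm y.2 hy).mdifferentiableAt
      ((isOpen_extChartAt_target c.2).mem_nhds hy)
  have h1 : HasMFDerivAt 𝓘(ℝ, ℝ × E) 𝓘(ℝ, ℝ) (Prod.fst : ℝ × E → ℝ) y
      (ContinuousLinearMap.fst ℝ ℝ E) := hasFDerivAt_fst.hasMFDerivAt
  have h2 : HasMFDerivAt 𝓘(ℝ, ℝ × E) 𝓘(ℝ, E) (Prod.snd : ℝ × E → E) y
      (ContinuousLinearMap.snd ℝ ℝ E) := hasFDerivAt_snd.hasMFDerivAt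
  have h3 := h1.prodMk (hs.hasMFDerivAt.comp y h2)
  have e : ((extChartAt (𝓘(ℝ, ℝ).prod I) c).symm : ℝ × E → ℝ × N) =
      fun y => (y.1, ((extChartAt I c.2).symm ∘ Prod.snd) y) :=
    funext fun y => extChartAt_symm_real_prod c y
  rw [e, h3.mfderiv]
  rfl

end Product

/-! ### The warped volume and Fubini -/

section WarpedVolume

variable {E : Type*} [NormedAddCommGroup E] [NormedSpace ℝ E]
  {H : Type*} [TopologicalSpace H] {I : ModelWithCorners ℝ E H} [I.Boundaryless]
  {N : Type*} [TopologicalSpace N] [ChartedSpace H N] [IsManifold I ∞ N]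
  {ρ : ℝ → ℝ}

/-- The metric coefficients of a warped product in a product chart. -/
theorem warpedMetric_inner_chart (hρ : ContDiff ℝ ∞ ρ) (g₀ : RiemMetric I N) (c : ℝ × N)
    {y : ℝ × E} (hy : y.2 ∈ (extChartAt I c.2).target) (v w : ℝ × E) :
    (warpedMetric hρ g₀).inner ((extChartAt (𝓘(ℝ, ℝ).prod I) c).symm y)
      (mfderiv 𝓘(ℝ, ℝ × E) (𝓘(ℝ, ℝ).prod I) (extChartAt (𝓘(ℝ, ℝ).prod I) c).symm y v)
      (mfderiv 𝓘(ℝ, ℝ × E) (𝓘(ℝ, ℝ).prod I) (extChartAt (𝓘(ℝ, ℝ).prod I) c).symm y w) =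
    v.1 * w.1 + Real.exp (2 * ρ y.1) * g₀.inner ((extChartAt I c.2).symm y.2)
      (mfderiv 𝓘(ℝ, E) I (extChartAt I c.2).symm y.2 v.2)
      (mfderiv 𝓘(ℝ, E) I (extChartAt I c.2).symm y.2 w.2) := by
  -- The base point is generalised so that it can be substituted although the tangent spaces depend
  -- on it.
  have key : ∀ (q : ℝ × N), q = (y.1, (extChartAt I c.2).symm y.2) → ∀ (a b a' b' : ℝ × E),
      a = a' → b = b' → (warpedForm (E := E) (Real.exp (2 * ρ q.1)) (g₀.inner q.2)) a b =
      a'.1 * b'.1 + Real.exp (2 * ρ y.1) *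
        ((g₀.inner ((extChartAt I c.2).symm y.2) : E →L[ℝ] E →L[ℝ] ℝ) a'.2 b'.2) := by
    rintro q rfl a b a' b' rfl rfl
    exact warpedForm_apply (E := E) _ _ _ _
  exact key _ (extChartAt_symm_real_prod c y) _ _ _ _
    (mfderiv_extChartAt_symm_real_prod c hy v) (mfderiv_extChartAt_symm_real_prod c hy w)

theorem warpedMetric_continuousOn_density (hρ : ContDiff ℝ ∞ ρ) (g₀ : RiemMetric I N) {ι : Type*}
    [Fintype ι] [DecidableEq ι] (b : Module.Basis ι ℝ (ℝ × E)) (c : ℝ × N) :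
    ContinuousOn (fun y : E => (warpedMetric hρ g₀).density b c (0, y))
      (extChartAt I c.2).target := by
  unfold RiemMetric.density
  refine Real.continuous_sqrt.comp_continuousOn ?_
  have h : ContinuousOn (fun y : E => Matrix.of fun i j => (b i).1 * (b j).1 +
      Real.exp (2 * ρ 0) * g₀.inner ((extChartAt I c.2).symm y)
      (mfderiv 𝓘(ℝ, E) I (extChartAt I c.2).symm y (b i).2)
      (mfderiv 𝓘(ℝ, E) I (extChartAt I c.2).symm y (b j).2)) (extChartAt I c.2).target :=
    continuousOn_pi.2 fun i => continuousOn_pi.2 fun j => continuousOn_const.add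
      (continuousOn_const.mul (g₀.continuousOn_inner_chart c.2 _ _))
  refine (Continuous.matrix_det continuous_id).comp_continuousOn (h.congr fun y hy => ?_)
  ext i j
  exact warpedMetric_inner_chart hρ g₀ c (y := (0, y)) hy (b i) (b j)

variable [FiniteDimensional ℝ E]

/-- The density factors into `e^{(n-1)ρ(t)}` and a function of the fibre coordinate. Comparison with
the slice `t = 0` avoids relating the basis of `ℝ × E` to one of `E`. -/
theorem warpedMetric_density (hρ : ContDiff ℝ ∞ ρ) (g₀ : RiemMetric I N) {ι : Type*} [Fintype ι]
    [DecidableEq ι] (b : Module.Basis ι ℝ (ℝ × E)) (c : ℝ × N) {y : ℝ × E}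
    (hy : y.2 ∈ (extChartAt I c.2).target) :
    (warpedMetric hρ g₀).density b c y =
      Real.exp (Module.finrank ℝ E * ρ y.1) * (Real.exp (-(Module.finrank ℝ E * ρ 0)) *
        (warpedMetric hρ g₀).density b c (0, y.2)) := by
  have hy0 : ((0, y.2) : ℝ × E).2 ∈ (extChartAt I c.2).target := hy
  unfold RiemMetric.density
  simp_rw [warpedMetric_inner_chart hρ g₀ c hy, warpedMetric_inner_chart hρ g₀ c hy0]
  let D : E →ₗ[ℝ] E := (mfderiv 𝓘(ℝ, E) I (extChartAt I c.2).symm y.2).toLinearMap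
  let B : LinearMap.BilinForm ℝ E :=
    LinearMap.BilinForm.comp (g₀.bilin ((extChartAt I c.2).symm y.2)) D D
  have h := det_warped b B (Real.exp (2 * ρ 0)) (Real.exp (ρ y.1 - ρ 0))
  have e : Real.exp (ρ y.1 - ρ 0) ^ 2 * Real.exp (2 * ρ 0) = Real.exp (2 * ρ y.1) := by
    rw [← Real.exp_nat_mul, ← Real.exp_add]; congr 1; push_cast; ring
  rw [e] at h
  refine (congrArg Real.sqrt h).trans ?_
  rw [Real.sqrt_mul (by positivity), Real.sqrt_sq (by positivity), ← mul_assoc, ← Real.exp_add,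
    ← Real.exp_nat_mul]
  have e2 : (Module.finrank ℝ E : ℝ) * (ρ y.1 - ρ 0) =
      Module.finrank ℝ E * ρ y.1 + -(Module.finrank ℝ E * ρ 0) := by ring
  rw [e2]
  rfl

variable [MeasurableSpace E] [BorelSpace E] [MeasurableSpace N] [BorelSpace N]

/-- Fubini for the warped volume in a product chart. -/
theorem exists_setLIntegral_chartVolume [SecondCountableTopology N] (hρ : ContDiff ℝ ∞ ρ)
    (g₀ : RiemMetric I N) (c : ℝ × N) {D : Set N} (hD : MeasurableSet D) :
    ∃ (ν : Measure E) (h : E → ℝ≥0∞) (ψ : E → N), ∀ F : ℝ × N → ℝ≥0∞, Measurable F →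
      ∫⁻ x in Prod.snd ⁻¹' D, F x ∂(warpedMetric hρ g₀).chartVolume c =
        ∫⁻ y, h y * (∫⁻ t, ENNReal.ofReal (Real.exp (Module.finrank ℝ E * ρ t)) *
          F (t, ψ y)) ∂ν := by
  set b := Module.finBasis ℝ (ℝ × E)
  set g := warpedMetric hρ g₀
  set T := (extChartAt I c.2).target
  set ψ := (extChartAt I c.2).symm
  set μ : Measure E := (Module.finBasis ℝ E).addHaar
  have hT : IsOpen T := isOpen_extChartAt_target c.2
  -- By uniqueness of Haar measure; the value of `C` is irrelevant, as it scales both sides of the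
  -- later comparison.
  obtain ⟨C, hC⟩ : ∃ C : ℝ≥0∞, b.addHaar = C • ((volume : Measure ℝ).prod μ) :=
    ⟨_, Measure.isAddLeftInvariant_eq_smul _ _⟩
  have htarget := extChartAt_target_real_prod (I := I) c
  have hres : b.addHaar.restrict (extChartAt (𝓘(ℝ, ℝ).prod I) c).target =
      C • ((volume : Measure ℝ).prod (μ.restrict T)) := by
    rw [htarget, hC, Measure.restrict_smul, ← Measure.prod_restrict, Measure.restrict_univ]
  have hmem : ∀ᵐ y ∂(b.addHaar.restrict (extChartAt (𝓘(ℝ, ℝ).prod I) c).target), y.2 ∈ T := by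
    rw [htarget]
    filter_upwards [ae_restrict_mem (MeasurableSet.univ.prod hT.measurableSet)] with y hy
    exact hy.2
  have hsymm : ((extChartAt (𝓘(ℝ, ℝ).prod I) c).symm : ℝ × E → ℝ × N) = fun y => (y.1, ψ y.2) :=
    funext fun y => extChartAt_symm_real_prod c y
  have hψ : AEMeasurable ψ (μ.restrict T) :=
    (continuousOn_extChartAt_symm c.2).aemeasurable hT.measurableSet
  have hδ0 : AEMeasurable (fun y => g.density b c (0, y)) (μ.restrict T) :=
    (warpedMetric_continuousOn_density hρ g₀ b c).aemeasurable hT.measurableSet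
  have hexp : Measurable fun t => ENNReal.ofReal (Real.exp (Module.finrank ℝ E * ρ t)) := by
    have := hρ.continuous.measurable
    fun_prop
  have hψ' : AEMeasurable (fun y : ℝ × E => (y.1, ψ y.2))
      ((volume : Measure ℝ).prod (μ.restrict T)) :=
    measurable_fst.aemeasurable.prodMk
      (hψ.comp_quasiMeasurePreserving Measure.quasiMeasurePreserving_snd)
  set h₀ : E → ℝ≥0∞ := fun y => ENNReal.ofReal
    (Real.exp (-(Module.finrank ℝ E * ρ 0)) * g.density b c (0, y))
  have hh₀ : AEMeasurable h₀ (μ.restrict T) := (hδ0.const_mul _).ennreal_ofReal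
  have hdens : (fun y => ENNReal.ofReal (g.density b c y)) =ᵐ[b.addHaar.restrict
      (extChartAt (𝓘(ℝ, ℝ).prod I) c).target] fun y =>
        ENNReal.ofReal (Real.exp (Module.finrank ℝ E * ρ y.1)) * h₀ y.2 := by
    filter_upwards [hmem] with y hy
    rw [warpedMetric_density hρ g₀ b c hy, ENNReal.ofReal_mul (Real.exp_pos _).le]
  have hδ : AEMeasurable (fun y : ℝ × E =>
      ENNReal.ofReal (Real.exp (Module.finrank ℝ E * ρ y.1)) * h₀ y.2)
      ((volume : Measure ℝ).prod (μ.restrict T)) :=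
    (hexp.comp measurable_fst).aemeasurable.mul
      (hh₀.comp_quasiMeasurePreserving Measure.quasiMeasurePreserving_snd)
  refine ⟨C • μ.restrict T, fun y => h₀ y * (ψ ⁻¹' D).indicator 1 y, ψ, fun F hF => ?_⟩
  have hDm : MeasurableSet (Prod.snd ⁻¹' D : Set (ℝ × N)) := measurable_snd hD
  have hFD : Measurable ((Prod.snd ⁻¹' D).indicator F) := hF.indicator hDm
  have hFDψ : AEMeasurable (fun y : ℝ × E => (Prod.snd ⁻¹' D).indicator F (y.1, ψ y.2))
      ((volume : Measure ℝ).prod (μ.restrict T)) := hFD.comp_aemeasurable hψ'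
  unfold RiemMetric.chartVolume
  rw [← lintegral_indicator hDm, hsymm, withDensity_congr_ae hdens, hres,
    lintegral_map' hFD.aemeasurable
      ((hψ'.smul_measure C).mono_ac (withDensity_absolutelyContinuous _ _)),
    lintegral_withDensity_eq_lintegral_mul₀ (hδ.smul_measure C) (hFDψ.smul_measure C),
    lintegral_smul_measure, lintegral_prod_symm _ (hδ.mul hFDψ), lintegral_smul_measure]
  congr 1
  refine lintegral_congr fun y => ?_
  -- A finite factor can be moved through the inner integral without a measurability condition.
  have hfin : h₀ y * (ψ ⁻¹' D).indicator 1 y ≠ ⊤ := by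
    refine ENNReal.mul_ne_top ENNReal.ofReal_ne_top ?_
    by_cases hy : y ∈ ψ ⁻¹' D <;> simp [hy]
  rw [← lintegral_const_mul' _ _ hfin]
  refine lintegral_congr fun t => ?_
  by_cases hy : ψ y ∈ D
  · simp [hy]; ring
  · simp [hy]

/-- Integral inequalities along the lines `t ↦ (t, x)` integrate to inequalities on the warped
product. -/
theorem lintegral_warpedMetric_mono [SecondCountableTopology N] [Nonempty N]
    (hρ : ContDiff ℝ ∞ ρ) (g₀ : RiemMetric I N) {F G : ℝ × N → ℝ≥0∞} (hF : Measurable F)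
    (hG : Measurable G)
    (h : ∀ x, ∫⁻ t, ENNReal.ofReal (Real.exp (Module.finrank ℝ E * ρ t)) * F (t, x) ≤
      ∫⁻ t, ENNReal.ofReal (Real.exp (Module.finrank ℝ E * ρ t)) * G (t, x)) :
    ∫⁻ x, F x ∂(warpedMetric hρ g₀).volume ≤ ∫⁻ x, G x ∂(warpedMetric hρ g₀).volume := by
  unfold RiemMetric.volume
  rw [lintegral_sum_measure, lintegral_sum_measure]
  refine ENNReal.tsum_le_tsum fun i => ?_
  set c := (exists_chart_centers (ModelProd ℝ H) (ℝ × N)).choose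
  -- The chart of `ℝ` is global, so chart domains, and the disjoint pieces cut from them, are
  -- cylinders `ℝ × D`. No line is cut, which is what allows inequalities along whole lines to be
  -- used piece by piece.
  have hsrc : (fun j => (chartAt (ModelProd ℝ H) (c j)).source) =
      fun j => Prod.snd ⁻¹' (chartAt H (c j).2).source := by
    funext j
    rw [prodChartedSpace_chartAt]
    ext x
    simp [chartAt_self_eq]
  have hdis : ∃ D : Set N, MeasurableSet D ∧
      disjointed (fun j => (chartAt (ModelProd ℝ H) (c j)).source) i = Prod.snd ⁻¹' D := by
    refine ⟨disjointed (fun j => (chartAt H (c j).2).source) i,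
      MeasurableSet.disjointed (fun j => (chartAt H (c j).2).open_source.measurableSet) i, ?_⟩
    rw [hsrc]
    ext x
    simp [disjointed_apply, Finset.sup_set_eq_biUnion]
  obtain ⟨D, hD, hDe⟩ := hdis
  rw [hDe]
  obtain ⟨ν, k, ψ, hk⟩ := exists_setLIntegral_chartVolume hρ g₀ (c i) hD
  rw [hk F hF, hk G hG]
  exact lintegral_mono fun y => mul_le_mul_right (h (ψ y)) _

end WarpedVolume

/-! ### Passage to `L^p` limits -/

section Limit

variable {α : Type*} [MeasurableSpace α] {μ : Measure α} {p : ℝ}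

theorem lintegral_rpow_le_add_sub (hp : 1 ≤ p) {f g : α → ℝ} (hf : AEMeasurable f μ)
    (hg : AEMeasurable g μ) :
    (∫⁻ x, ENNReal.ofReal |f x| ^ p ∂μ) ^ (1 / p) ≤
      (∫⁻ x, ENNReal.ofReal |g x| ^ p ∂μ) ^ (1 / p) +
        (∫⁻ x, ENNReal.ofReal |f x - g x| ^ p ∂μ) ^ (1 / p) := by
  have hp0 : 0 ≤ p := by linarith
  refine le_trans ?_ (ENNReal.lintegral_Lp_add_le
    (f := fun x => ENNReal.ofReal |g x|) (g := fun x => ENNReal.ofReal |f x - g x|)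
    hg.abs.ennreal_ofReal (hf.sub hg).abs.ennreal_ofReal hp)
  refine ENNReal.rpow_le_rpow (lintegral_mono fun x => ENNReal.rpow_le_rpow ?_ hp0) (by positivity)
  rw [Pi.add_apply, ← ENNReal.ofReal_add (abs_nonneg _) (abs_nonneg _)]
  refine ENNReal.ofReal_le_ofReal ?_
  have := abs_add_le (g x) (f x - g x)
  simpa using this

/-- An `L^p` inequality passes to `L^p` limits. -/
theorem lintegral_rpow_le_of_approx (hp : 1 ≤ p) {c : ℝ} (hc : 0 ≤ c) {u a : α → ℝ}
    {φ ψ : ℕ → α → ℝ} (hu : AEMeasurable u μ) (ha : AEMeasurable a μ)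
    (hφ : ∀ k, AEMeasurable (φ k) μ) (hψ : ∀ k, AEMeasurable (ψ k) μ)
    (hle : ∀ k, ENNReal.ofReal (c ^ p) * ∫⁻ x, ENNReal.ofReal |φ k x| ^ p ∂μ ≤
      ∫⁻ x, ENNReal.ofReal |ψ k x| ^ p ∂μ)
    (hφu : Tendsto (fun k => ∫⁻ x, ENNReal.ofReal |φ k x - u x| ^ p ∂μ) atTop (𝓝 0))
    (hψa : Tendsto (fun k => ∫⁻ x, ENNReal.ofReal |ψ k x - a x| ^ p ∂μ) atTop (𝓝 0)) :
    ENNReal.ofReal (c ^ p) * ∫⁻ x, ENNReal.ofReal |u x| ^ p ∂μ ≤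
      ∫⁻ x, ENNReal.ofReal |a x| ^ p ∂μ := by
  have hp0 : 0 < p := by linarith
  have hp1 : 0 < 1 / p := by positivity
  have hroot : ∀ A : ℝ≥0∞, (ENNReal.ofReal (c ^ p) * A) ^ (1 / p) =
      ENNReal.ofReal c * A ^ (1 / p) := fun A => by
    rw [ENNReal.mul_rpow_of_nonneg _ _ hp1.le, ← ENNReal.ofReal_rpow_of_nonneg hc hp0.le,
      ← ENNReal.rpow_mul, mul_one_div_cancel hp0.ne', ENNReal.rpow_one]
  rw [← ENNReal.rpow_le_rpow_iff hp1, hroot]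
  have ht : ∀ {s : ℕ → ℝ≥0∞}, Tendsto s atTop (𝓝 0) →
      Tendsto (fun k => s k ^ (1 / p)) atTop (𝓝 0) := fun {s} hs => by
    have := (ENNReal.continuous_rpow_const (y := 1 / p)).tendsto 0 |>.comp hs
    rwa [ENNReal.zero_rpow_of_pos hp1] at this
  -- Two triangle inequalities give `c‖u‖ ≤ ‖a‖ + ‖ψ_k - a‖ + c‖φ_k - u‖` in `L^p`; this is the
  -- limit of the right-hand side.
  have hlim : Tendsto (fun k => (∫⁻ x, ENNReal.ofReal |a x| ^ p ∂μ) ^ (1 / p) +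
      (∫⁻ x, ENNReal.ofReal |ψ k x - a x| ^ p ∂μ) ^ (1 / p) +
      ENNReal.ofReal c * (∫⁻ x, ENNReal.ofReal |φ k x - u x| ^ p ∂μ) ^ (1 / p)) atTop
      (𝓝 ((∫⁻ x, ENNReal.ofReal |a x| ^ p ∂μ) ^ (1 / p) + 0 + ENNReal.ofReal c * 0)) :=
    (tendsto_const_nhds.add (ht hψa)).add
      (ENNReal.Tendsto.const_mul (ht hφu) (Or.inr ENNReal.ofReal_ne_top))
  rw [add_zero, mul_zero, add_zero] at hlim
  refine ge_of_tendsto' hlim fun k => ?_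
  have h1 := lintegral_rpow_le_add_sub hp hu (hφ k)
  simp_rw [abs_sub_comm (u _)] at h1
  have h2 := ENNReal.rpow_le_rpow (hle k) hp1.le
  rw [hroot] at h2
  calc ENNReal.ofReal c * (∫⁻ x, ENNReal.ofReal |u x| ^ p ∂μ) ^ (1 / p)
      ≤ ENNReal.ofReal c * (∫⁻ x, ENNReal.ofReal |φ k x| ^ p ∂μ) ^ (1 / p) +
        ENNReal.ofReal c * (∫⁻ x, ENNReal.ofReal |φ k x - u x| ^ p ∂μ) ^ (1 / p) := by
        rw [← mul_add]; exact mul_le_mul_right h1 _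
    _ ≤ _ := add_le_add_left (h2.trans (lintegral_rpow_le_add_sub hp (hψ k) ha)) _

end Limit

/-! ### Radial derivatives and the Poincaré inequality -/

theorem measurable_deriv_slice {N : Type*} [TopologicalSpace N] [MeasurableSpace N] [BorelSpace N]
    [SecondCountableTopology N] {φ : ℝ × N → ℝ} (hφ : Continuous φ) :
    Measurable fun q : ℝ × N => deriv (fun s => φ (s, q.2)) q.1 :=
  (measurable_deriv_with_param (f := fun (x : N) (s : ℝ) => φ (s, x))
    (hφ.comp continuous_swap)).comp measurable_swap

theorem warpedForm_apply_one_zero {E : Type*} [NormedAddCommGroup E] [NormedSpace ℝ E] (c : ℝ)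
    (B : E →L[ℝ] E →L[ℝ] ℝ) (w : ℝ × E) : warpedForm c B w (1, 0) = w.1 := by
  rw [warpedForm_apply, map_zero]
  ring

section Poincare

variable {E : Type*} [NormedAddCommGroup E] [NormedSpace ℝ E]
  {H : Type*} [TopologicalSpace H] {I : ModelWithCorners ℝ E H}
  {N : Type*} [TopologicalSpace N] [ChartedSpace H N]

theorem contDiff_slice {φ : ℝ × N → ℝ} (hφ : ContMDiff (𝓘(ℝ, ℝ).prod I) 𝓘(ℝ, ℝ) ∞ φ) (x : N) :
    ContDiff ℝ ∞ fun s => φ (s, x) :=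
  contMDiff_iff_contDiff.1 (hφ.comp (contMDiff_id.prodMk contMDiff_const))

theorem hasCompactSupport_slice {φ : ℝ × N → ℝ} (hφ : HasCompactSupport φ) (x : N) :
    HasCompactSupport fun s => φ (s, x) :=
  HasCompactSupport.of_support_subset_isCompact (hφ.isCompact.image continuous_fst)
    fun s hs => ⟨(s, x), subset_tsupport φ hs, rfl⟩

theorem mfderiv_apply_fst {φ : ℝ × N → ℝ} (hφ : ContMDiff (𝓘(ℝ, ℝ).prod I) 𝓘(ℝ, ℝ) ∞ φ)
    (q : ℝ × N) :
    mfderiv (𝓘(ℝ, ℝ).prod I) 𝓘(ℝ, ℝ) φ q ((1, 0) : ℝ × E) = deriv (fun s => φ (s, q.2)) q.1 := by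
  have h1 : HasMFDerivAt 𝓘(ℝ, ℝ) (𝓘(ℝ, ℝ).prod I) (fun s : ℝ => (s, q.2)) q.1
      (ContinuousLinearMap.inl ℝ ℝ E) :=
    (hasMFDerivAt_id (I := 𝓘(ℝ, ℝ)) q.1).prodMk (hasMFDerivAt_const (I' := I) q.2 q.1)
  have h2 := ((hφ q).mdifferentiableAt (by simp)).hasMFDerivAt
  obtain ⟨L, hL⟩ : ∃ L : (ℝ × E) →L[ℝ] ℝ, L = mfderiv (𝓘(ℝ, ℝ).prod I) 𝓘(ℝ, ℝ) φ q := ⟨_, rfl⟩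
  have h3 : HasFDerivAt (fun s => φ (s, q.2)) (L.comp (ContinuousLinearMap.inl ℝ ℝ E)) q.1 := by
    rw [hL]
    exact (HasMFDerivAt.comp q.1 (g := φ) h2 h1).hasFDerivAt
  rw [h3.hasDerivAt.deriv, ← hL]
  rfl

variable [IsManifold I ∞ N] {ρ : ℝ → ℝ}

/-- The radial component is the fibre part of the tangent map of the projection to `ℝ`. It makes the
radial part of a weak gradient measurable. -/
theorem continuous_tangent_fst :
    Continuous fun v : TangentBundle (𝓘(ℝ, ℝ).prod I) (ℝ × N) => (show ℝ × E from v.2).1 := by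
  have h : Continuous (tangentMap (𝓘(ℝ, ℝ).prod I) 𝓘(ℝ, ℝ) (Prod.fst : ℝ × N → ℝ)) :=
    (contMDiff_fst (n := 1)).continuous_tangentMap le_rfl
  have h2 : Continuous fun v : TangentBundle 𝓘(ℝ, ℝ) ℝ => (show ℝ from v.2) :=
    continuous_snd.comp (tangentBundleModelSpaceHomeomorph 𝓘(ℝ, ℝ)).continuous
  refine (h2.comp h).congr fun v => ?_
  exact congrArg (fun w : TangentBundle 𝓘(ℝ, ℝ) ℝ => (show ℝ from w.2)) tangentMap_prodFst

theorem abs_fst_le_norm (hρ : ContDiff ℝ ∞ ρ) (g₀ : RiemMetric I N) (q : ℝ × N)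
    (v : TangentSpace (𝓘(ℝ, ℝ).prod I) q) :
    |(show ℝ × E from v).1| ≤ (warpedMetric hρ g₀).norm q v := by
  refine Real.abs_le_sqrt ?_
  have h : (warpedMetric hρ g₀).inner q v v = (show ℝ × E from v).1 * (show ℝ × E from v).1 +
      Real.exp (2 * ρ q.1) * g₀.inner q.2 (show ℝ × E from v).2 (show ℝ × E from v).2 :=
    warpedForm_apply (E := E) _ _ _ _
  have h0 : 0 ≤ g₀.inner q.2 (show ℝ × E from v).2 (show ℝ × E from v).2 := by
    by_cases hv : (show TangentSpace I q.2 from (show ℝ × E from v).2) = 0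
    · have : g₀.inner q.2 (show TangentSpace I q.2 from (show ℝ × E from v).2)
        (show TangentSpace I q.2 from (show ℝ × E from v).2) = 0 := by rw [hv]; simp
      exact this.ge
    · exact (g₀.pos q.2 _ hv).le
  rw [h, sq]
  exact le_add_of_nonneg_right (mul_nonneg (Real.exp_pos _).le h0)

variable [FiniteDimensional ℝ E]

theorem warpedMetric_gradient_fst (hρ : ContDiff ℝ ∞ ρ) (g₀ : RiemMetric I N) {φ : ℝ × N → ℝ}
    (hφ : ContMDiff (𝓘(ℝ, ℝ).prod I) 𝓘(ℝ, ℝ) ∞ φ) (q : ℝ × N) :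
    (show ℝ × E from (warpedMetric hρ g₀).gradient φ q).1 = deriv (fun s => φ (s, q.2)) q.1 := by
  rw [← mfderiv_apply_fst hφ q]
  refine Eq.trans ?_ ((warpedMetric hρ g₀).inner_gradient φ q
    (show TangentSpace (𝓘(ℝ, ℝ).prod I) q from ((1, 0) : ℝ × E)))
  exact (warpedForm_apply_one_zero (E := E) _ (g₀.inner q.2) _).symm

variable [I.Boundaryless] [MeasurableSpace E] [BorelSpace E] [MeasurableSpace N] [BorelSpace N]
  [SecondCountableTopology N] [Nonempty N]

/-- Hardy's inequality on each line, with `w = e^{(n-1)ρ}` and `c = (n-1)κ/p`: then `p c = (n-1)κ`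
is a lower bound for `w'/w = (n-1)ρ'`. -/
theorem warpedMetric_poincare_testFunction (hρ : ContDiff ℝ ∞ ρ) (g₀ : RiemMetric I N) {p κ : ℝ}
    (hp : 1 < p) (hκ : 0 < κ) (hκρ : ∀ t, κ ≤ deriv ρ t) {φ : ℝ × N → ℝ} {Ω : Set (ℝ × N)}
    (hφ : IsTestFunction (𝓘(ℝ, ℝ).prod I) Ω φ) :
    ENNReal.ofReal ((Module.finrank ℝ E * κ / p) ^ p) *
      ∫⁻ x, ENNReal.ofReal |φ x| ^ p ∂(warpedMetric hρ g₀).volume ≤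
      ∫⁻ q, ENNReal.ofReal |deriv (fun s => φ (s, q.2)) q.1| ^ p ∂(warpedMetric hρ g₀).volume := by
  have hp0 : 0 < p := by linarith
  have hφc : Continuous φ := hφ.contMDiff.continuous
  rw [← lintegral_const_mul' _ _ ENNReal.ofReal_ne_top]
  refine lintegral_warpedMetric_mono hρ g₀
    (((hφc.measurable.abs.ennreal_ofReal).pow_const p).const_mul _)
    (((measurable_deriv_slice hφc).abs.ennreal_ofReal).pow_const p) fun x => ?_
  have hw : ContDiff ℝ 1 fun t => Real.exp (Module.finrank ℝ E * ρ t) :=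
    (contDiff_const.mul (hρ.of_le (by simp))).exp
  have hd : ∀ t, HasDerivAt (fun t => Real.exp (Module.finrank ℝ E * ρ t))
      (Real.exp (Module.finrank ℝ E * ρ t) * (Module.finrank ℝ E * deriv ρ t)) t := fun t =>
    ((hρ.differentiable (by simp) t).hasDerivAt.const_mul _).exp
  have h := weighted_hardy_lintegral (c := Module.finrank ℝ E * κ / p) hp (by positivity) hw
    (fun t => (Real.exp_pos _).le) (fun t => ?_) ((contDiff_slice hφ.contMDiff x).of_le (by simp))
    (hasCompactSupport_slice hφ.hasCompactSupport x)
  · refine le_trans (le_of_eq ?_) h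
    rw [← lintegral_const_mul' _ _ ENNReal.ofReal_ne_top]
    exact lintegral_congr fun t => by ring
  · rw [(hd t).deriv, mul_div_cancel₀ _ hp0.ne', mul_comm]
    have : (0 : ℝ) ≤ Module.finrank ℝ E := by positivity
    gcongr
    exact hκρ t

/-- The limit is taken for `u` paired with the radial component of `X`, a scalar function; only
afterwards is that component bounded by the norm of `X`. -/
theorem warpedMetric_poincare (hρ : ContDiff ℝ ∞ ρ) (g₀ : RiemMetric I N) {p κ : ℝ}
    (hp : 1 < p) (hκ : 0 < κ) (hκρ : ∀ t, κ ≤ deriv ρ t) {Ω : Set (ℝ × N)} (hΩ : IsOpen Ω)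
    {u : ℝ × N → ℝ} {X : ∀ q : ℝ × N, TangentSpace (𝓘(ℝ, ℝ).prod I) q}
    (hu : (warpedMetric hρ g₀).MemW0 p Ω u X) :
    ENNReal.ofReal ((Module.finrank ℝ E * κ / p) ^ p) *
      ∫⁻ x in Ω, ENNReal.ofReal |u x| ^ p ∂(warpedMetric hρ g₀).volume ≤
      ∫⁻ x in Ω, ENNReal.ofReal ((warpedMetric hρ g₀).norm x (X x)) ^ p
        ∂(warpedMetric hρ g₀).volume := by
  have hp0 : 0 < p := by linarith
  obtain ⟨φ, hφ, h1, h2⟩ := hu.exists_approx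
  have hX : AEMeasurable (fun q => (show ℝ × E from X q).1)
      ((warpedMetric hρ g₀).volume.restrict Ω) := by
    let : MeasurableSpace (TangentBundle (𝓘(ℝ, ℝ).prod I) (ℝ × N)) := borel _
    have : BorelSpace (TangentBundle (𝓘(ℝ, ℝ).prod I) (ℝ × N)) := ⟨rfl⟩
    exact (continuous_tangent_fst (I := I) (N := N)).measurable.comp_aemeasurable
      hu.aemeasurable_grad
  refine (lintegral_rpow_le_of_approx hp.le (by positivity) hu.aemeasurable hX
    (fun k => (hφ k).contMDiff.continuous.measurable.aemeasurable)
    (fun k => (measurable_deriv_slice (hφ k).contMDiff.continuous).aemeasurable) (fun k => ?_) h1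
    ?_).trans (lintegral_mono fun q => ENNReal.rpow_le_rpow
      (ENNReal.ofReal_le_ofReal (abs_fst_le_norm hρ g₀ q (X q))) hp0.le)
  -- The inequality for test functions lives on all of `ℝ × N`. On the right it returns to `Ω`
  -- because the radial derivative vanishes off the support.
  · refine (mul_le_mul_right (setLIntegral_le_lintegral Ω _) _).trans
      ((warpedMetric_poincare_testFunction hρ g₀ hp hκ hκρ (hφ k)).trans (le_of_eq ?_))
    rw [← setLIntegral_univ]
    refine lintegral_eq_of_eq_zero_off hΩ.measurableSet (subset_univ _) fun q hq => ?_
    have hz : deriv (fun s => φ k (s, q.2)) q.1 = 0 := by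
      rw [← mfderiv_apply_fst (hφ k).contMDiff q,
        mfderiv_eq_zero_of_notMem_tsupport fun hh => hq ((hφ k).tsupport_subset hh)]
      rfl
    simp [hz, hp0]
  · refine tendsto_of_tendsto_of_tendsto_of_le_of_le tendsto_const_nhds h2 (fun _ => zero_le)
      fun k => lintegral_mono fun q => ENNReal.rpow_le_rpow (ENNReal.ofReal_le_ofReal ?_) hp0.le
    refine le_trans (le_of_eq ?_) (abs_fst_le_norm hρ g₀ q _)
    rw [← warpedMetric_gradient_fst hρ g₀ (hφ k).contMDiff q]
    rfl

/-- The first eigenvalue of a domain in a warped product of exponential growth is bounded below. -/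
theorem warpedMetric_le_firstEigenvalue (hρ : ContDiff ℝ ∞ ρ) (g₀ : RiemMetric I N) {p κ : ℝ}
    (hp : 1 < p) (hκ : 0 < κ) (hκρ : ∀ t, κ ≤ deriv ρ t) {Ω : Set (ℝ × N)} (hΩ : IsOpen Ω) :
    ENNReal.ofReal ((Module.finrank ℝ E * κ / p) ^ p) ≤
      (warpedMetric hρ g₀).firstEigenvalue p Ω := by
  have hp0 : 0 < p := by linarith
  refine le_sInf ?_
  rintro r ⟨u, X, hu, hne, rfl⟩
  -- Clearing the denominator needs it finite, which membership in `W₀^{1,p}` gives, and nonzero,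
  -- which holds since `u` is not a.e. zero.
  refine (ENNReal.le_div_iff_mul_le (Or.inl fun h0 => hne ?_)
    (Or.inl hu.lintegral_lt_top.ne)).2 (warpedMetric_poincare hρ g₀ hp hκ hκρ hΩ hu)
  rw [lintegral_eq_zero_iff' (hu.aemeasurable.abs.ennreal_ofReal.pow_const p)] at h0
  filter_upwards [h0] with x hx
  simpa [ENNReal.rpow_eq_zero_iff, hp0, hp0.not_gt] using hx

end Poincare

end PTone

theorem corollary2 (n : ℕ) (hn : 2 ≤ n) (p : ℝ) (hp : 1 < p)
    {N : Type*} [TopologicalSpace N] [ChartedSpace (EuclideanSpace ℝ (Fin (n - 1))) N]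
    [IsManifold (𝓡 (n - 1)) ∞ N] [T2Space N] [SecondCountableTopology N] [Nonempty N]
    [MeasurableSpace N] [BorelSpace N]
    (g₀ : PTone.RiemMetric (𝓡 (n - 1)) N)
    (ρ : ℝ → ℝ) (hρ : ContDiff ℝ ∞ ρ)
    (κ : ℝ) (hκ : 0 < κ) (hκρ : ∀ t, κ ≤ deriv ρ t) :
    ∃ L : ℝ≥0∞, (PTone.warpedMetric hρ g₀).IsFundamentalTone p L ∧
      ENNReal.ofReal (((n : ℝ) - 1) ^ p / p ^ p * κ ^ p) ≤ L := by
  -- Local compactness provides a compact exhaustion of `ℝ × N`.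
  have : LocallyCompactSpace N :=
    ChartedSpace.locallyCompactSpace (EuclideanSpace ℝ (Fin (n - 1))) N
  obtain ⟨Ω, hΩ⟩ := PTone.exists_isExhaustion (M := ℝ × N)
  refine ⟨_, PTone.RiemMetric.isFundamentalTone_iInf _ (by linarith) hΩ, le_iInf fun k => ?_⟩
  refine le_trans (le_of_eq ?_)
    (PTone.warpedMetric_le_firstEigenvalue hρ g₀ hp hκ hκρ (hΩ.isOpen k))
  have hn1 : (0 : ℝ) ≤ (n : ℝ) - 1 := by
    have : (1 : ℝ) ≤ n := by exact_mod_cast (by omega : 1 ≤ n)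
    linarith
  rw [finrank_euclideanSpace_fin, Nat.cast_sub (by omega), Nat.cast_one,
    Real.div_rpow (by positivity) (by linarith), Real.mul_rpow hn1 hκ.le]
  congr 1
  ring
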